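/- Let $R$ be a commutative ring. A partitioned permutation of $[d]=\{1,\dots,d\}$ is a pair $(\mathcal A,\alpha)$ of a set partition $\mathcal A$ of $[d]$ and a permutation $\alpha\in S(d)$ such that every cycle of $\alpha$ is contained in a block of $\mathcal A$; $PS(d)$ is the set of these and $PS=\bigcup_{d\ge 0}PS(d)$. Let $\mathbf 0_\alpha$ be the partition of $[d]$ into supports of cycles of $\alpha$, and $\mathbf 1_d$ the one-block partition. The colength is $|(\mathcal A,\alpha)|=2(d-\#\mathcal A)-(d-\#\mathbf 0_\alpha)$. Put $(\mathcal A,\alpha)\cdot(\mathcal B,\beta)=(\mathcal A\vee\mathcal B,\alpha\circ\beta)$ if $|(\mathcal A,\alpha)|+|(\mathcal B,\beta)|=|(\mathcal A\vee\mathcal B,\alpha\circ\beta)|$, and $0$ otherwise. The convolution of two functions on $PS$ with values in a commutative ring is $$(f_1*f_2)(\mathcal C,\gamma)=\sum_{(\mathcal A,\alpha)\cdot(\mathcal B,\beta)=(\mathcal C,\gamma)}f_1(\mathcal A,\alpha)f_2(\mathcal B,\beta),$$ and $\zeta(\mathcal A,\alpha)=1$ if $\mathcal A=\mathbf 0_\alpha$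 and $0$ otherwise. A function $f$ on $PS$ is multiplicative if $f(\mathbf 1_d,\sigma)$ depends only on the conjugacy class of $\sigma\in S(d)$ for every $d\geq 0$, and $f(\mathcal A,\alpha)=\prod_{A\in\mathcal A}f(\mathbf 1_{\#A},\alpha_{|A})$ for all $(\mathcal A,\alpha)\in PS$. Let $\phi,\phi',\phi^\vee,\phi'^\vee\colon PS\to R$ be functions such that ${}^\flat\phi=\phi+\hbar\phi'$ and ${}^\flat\phi^\vee=\phi^\vee+\hbar\phi'^\vee$, with values in the ring of dual numbers $R'=R[\![\hbar]\!]/(\hbar^2)$, are multiplicative, and suppose that ${}^\flat\phi=\zeta*{}^\flat\phi^\vee$. Introduce the genus $0$ and genus $\frac12$ one-point series $$G_{0,1}(X)=1+\sum_{k>0}\phi(\mathbf 1_k,(1\,2\cdots k))X^k,\qquad G_{\frac12,1}(X)=\sum_{k>0}\phi'(\mathbf 1_k,(1\,2\cdots k))X^k,$$ and likewise $G^\vee_{0,1}(w)$ and $G^\vee_{\frac12,1}(w)$ from $\phi^\vee$ and $\phi'^\vee$. Under the substitution $$X=\frac{w}{G^\vee_{0,1}(w)},\qquad P^\vee(w)=\frac{\mathrm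 d\ln w}{\mathrm d\ln X},$$ the following identities of formal series in $w$ hold: $$G_{0,1}(X)=G^\vee_{0,1}(w),\qquad G_{\frac12,1}(X)=P^\vee(w)\,G^\vee_{\frac12,1}(w).$$ The second one also holds in the equivalent form, as an identity between formal differentials in $w$, $$G_{\frac12,1}(X)\,\frac{\mathrm dX}{X}=G^\vee_{\frac12,1}(w)\,\frac{\mathrm dw}{w}.$$ (These are the functional relations known between the generating series of moments and of free cumulants in infinitesimal freeness.) -/

import Mathlib

open scoped PowerSeries

/-! ### Partitioned permutations -/

/-- A partitioned permutation of `d` elements: a set partition of `Fin d` (as an equivalence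
relation; the blocks are its classes, and `≤`, `⊔` are refinement and merging) and a permutation
each of whose cycles is contained in a block. -/
@[ext]
structure PartitionedPerm (d : ℕ) where
  part : Setoid (Fin d)
  perm : Equiv.Perm (Fin d)
  cycles_le : Equiv.Perm.SameCycle.setoid perm ≤ part

namespace PartitionedPerm

theorem rel_apply {d : ℕ} (p : PartitionedPerm d) (x : Fin d) : p.part x (p.perm x) :=
  p.cycles_le ⟨1, by simp⟩

noncomputable instance (d : ℕ) : Fintype (PartitionedPerm d) :=
  haveI : Finite (Setoid (Fin d)) :=
    Finite.of_injective (fun s : Setoid (Fin d) => (s : Fin d → Fin d → Prop))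
      (fun _ _ h => Setoid.ext fun a b => iff_of_eq (congrFun (congrFun h a) b))
  haveI : Finite (PartitionedPerm d) :=
    Finite.of_injective (fun p : PartitionedPerm d => (p.part, p.perm))
      (fun _ _ h => PartitionedPerm.ext (congrArg Prod.fst h) (congrArg Prod.snd h))
  Fintype.ofFinite _

/-- The partitioned permutation `(1_d, σ)` with the one-block partition (no block if `d = 0`). -/
def full {d : ℕ} (σ : Equiv.Perm (Fin d)) : PartitionedPerm d := ⟨⊤, σ, le_top⟩

/-- The colength `2 (d - #blocks) - (d - #cycles)`. -/
noncomputable def colength {d : ℕ} (p : PartitionedPerm d) : ℤ :=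
  2 * ((d : ℤ) - Nat.card (Quotient p.part)) -
    ((d : ℤ) - Nat.card (Quotient (Equiv.Perm.SameCycle.setoid p.perm)))

/-- Merging of the partitions and composition of the permutations. -/
def extMul {d : ℕ} (p q : PartitionedPerm d) : PartitionedPerm d where
  part := p.part ⊔ q.part
  perm := p.perm * q.perm
  cycles_le := by
    have step : ∀ x, (p.part ⊔ q.part) x ((p.perm * q.perm) x) := fun x =>
      (p.part ⊔ q.part).trans
        ((le_sup_right : q.part ≤ p.part ⊔ q.part) (q.rel_apply x))
        ((le_sup_left : p.part ≤ p.part ⊔ q.part) (p.rel_apply (q.perm x)))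
    rintro x y ⟨i, rfl⟩
    induction i using Int.induction_on with
    | zero => exact (p.part ⊔ q.part).refl _
    | succ i ih =>
      rw [add_comm, zpow_add, zpow_one, Equiv.Perm.mul_apply]
      exact (p.part ⊔ q.part).trans ih (step _)
    | pred i ih =>
      refine (p.part ⊔ q.part).trans ih ((p.part ⊔ q.part).symm ?_)
      have h := step (((p.perm * q.perm) ^ (-(i : ℤ) - 1)) x)
      rwa [← Equiv.Perm.mul_apply, ← zpow_one_add, add_sub_cancel] at h

open Classical in
/-- The product of partitioned permutations; `none` is the absorbing element `0`. -/
noncomputable def mul {d : ℕ} (p q : PartitionedPerm d) : Option (PartitionedPerm d) :=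
  if p.colength + q.colength = (p.extMul q).colength then some (p.extMul q) else none

/-- The restriction of the permutation to a block, transported to `Fin m` (with `m` the size of the
block) by some bijection. -/
noncomputable def restrict {d : ℕ} (p : PartitionedPerm d) (A : Quotient p.part) :
    Equiv.Perm (Fin (Nat.card {x : Fin d // Quotient.mk p.part x = A})) :=
  (Finite.equivFin {x : Fin d // Quotient.mk p.part x = A}).permCongr
    (p.perm.subtypePerm fun x => by
      rw [(Quotient.sound (p.rel_apply x) :
        Quotient.mk p.part x = Quotient.mk p.part (p.perm x))])

end PartitionedPerm

/-- Functions on the set of all partitioned permutations, of any number `d ≥ 0` of elements. -/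
abbrev PSFun (S : Type*) : Type _ := ∀ d : ℕ, PartitionedPerm d → S

namespace PSFun

open Classical in
/-- The zeta function: `1` if the blocks are exactly the supports of the cycles, `0` otherwise. -/
noncomputable def zeta (S : Type*) [CommRing S] : PSFun S := fun _ p =>
  if p.part = Equiv.Perm.SameCycle.setoid p.perm then 1 else 0

open Classical in
/-- The convolution: `(f * g)(c)` is the sum of `f a * g b` over the factorisations `a · b = c`. -/
noncomputable def conv {S : Type*} [CommRing S] (f g : PSFun S) : PSFun S := fun d c =>
  ∑ ab : PartitionedPerm d × PartitionedPerm d with ab.1.mul ab.2 = some c, f d ab.1 * g d ab.2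

open Classical in
/-- Multiplicative functions. By the first property, the choice of bijections in `restrict` has
no influence on the second one. -/
structure IsMultiplicative {S : Type*} [CommRing S] (f : PSFun S) : Prop where
  conj : ∀ (d : ℕ) (σ τ : Equiv.Perm (Fin d)), IsConj σ τ →
    f d (PartitionedPerm.full σ) = f d (PartitionedPerm.full τ)
  prod : ∀ (d : ℕ) (p : PartitionedPerm d),
    f d p = ∏ A : Quotient p.part, f _ (PartitionedPerm.full (p.restrict A))

/-- The function `φ + ħ φ'` with values in the dual numbers `R⟦ħ⟧ / (ħ²)`. -/
def flat {R : Type*} [CommRing R] (φ φ' : PSFun R) : PSFun (DualNumber R) := fun d p =>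
  TrivSqZeroExt.inl (φ d p) + TrivSqZeroExt.inr (φ' d p)

/-- The genus `0` one-point series `1 + ∑_{k > 0} φ(1_k, (1 2 ⋯ k)) X^k`. -/
noncomputable def genusZeroSeries {R : Type*} [CommRing R] (φ : PSFun R) : R⟦X⟧ :=
  PowerSeries.mk fun k => if k = 0 then 1 else φ k (PartitionedPerm.full (finRotate k))

/-- The genus `1/2` one-point series `∑_{k > 0} φ'(1_k, (1 2 ⋯ k)) X^k`. -/
noncomputable def genusHalfSeries {R : Type*} [CommRing R] (φ' : PSFun R) : R⟦X⟧ :=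
  PowerSeries.mk fun k => if k = 0 then 0 else φ' k (PartitionedPerm.full (finRotate k))

end PSFun

/-! ### The change of variable -/

/-- The series `X(w) = w / G(w)`, for `G` with constant term `1`. -/
noncomputable def changeVar {R : Type*} [CommRing R] (G : R⟦X⟧) : R⟦X⟧ :=
  PowerSeries.X * PowerSeries.invOfUnit G 1

/-- The series `d ln w / d ln X = (X(w) / w) / (dX / dw)`, where `X(w) = w / G(w)` and `G` has
constant term `1`. -/
noncomputable def logDerivRatio {R : Type*} [CommRing R] (G : R⟦X⟧) : R⟦X⟧ :=
  PowerSeries.invOfUnit G 1 *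
    PowerSeries.invOfUnit (PowerSeries.derivative R (changeVar G)) 1

/-- The logarithmic differential `du / u` of a series `u(w)` that is invertible as a Laurent series
in `w`. A differential `f(w) dw` is represented by its coefficient `f(w)`. -/
noncomputable def dlog {R : Type*} [CommRing R] (u : R⟦X⟧) : LaurentSeries R :=
  ((PowerSeries.derivative R u : R⟦X⟧) : LaurentSeries R) * Ring.inverse (u : LaurentSeries R)

section Checks

variable {R : Type*} [CommRing R]

theorem PSFun.constantCoeff_genusZeroSeries (φ : PSFun R) :
    PowerSeries.constantCoeff φ.genusZeroSeries = 1 := by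
  simp [PSFun.genusZeroSeries, ← PowerSeries.coeff_zero_eq_constantCoeff_apply]

theorem changeVar_mul (G : R⟦X⟧) (hG : PowerSeries.constantCoeff G = 1) :
    changeVar G * G = PowerSeries.X := by
  rw [changeVar, mul_assoc, mul_comm _ G, PowerSeries.mul_invOfUnit G 1 (by simpa using hG),
    mul_one]

theorem hasSubst_changeVar (G : R⟦X⟧) : PowerSeries.HasSubst (changeVar G) :=
  PowerSeries.HasSubst.of_constantCoeff_zero' (by
    rw [changeVar, map_mul, PowerSeries.constantCoeff_X, zero_mul])

theorem constantCoeff_derivative_changeVar (G : R⟦X⟧) :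
    PowerSeries.constantCoeff (PowerSeries.derivative R (changeVar G)) = 1 := by
  rw [← PowerSeries.coeff_zero_eq_constantCoeff_apply, PowerSeries.coeff_derivative, changeVar,
    PowerSeries.coeff_succ_X_mul]
  simp

theorem isUnit_coe_X : IsUnit ((PowerSeries.X : R⟦X⟧) : LaurentSeries R) := by
  refine IsUnit.of_mul_eq_one (HahnSeries.single (-1 : ℤ) (1 : R)) ?_
  simp

theorem isUnit_coe_changeVar (G : R⟦X⟧) (hG : PowerSeries.constantCoeff G = 1) :
    IsUnit ((changeVar G : R⟦X⟧) : LaurentSeries R) := by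
  refine isUnit_of_mul_isUnit_left (y := (G : LaurentSeries R)) ?_
  rw [← PowerSeries.coe_mul, changeVar_mul G hG]
  exact isUnit_coe_X

/-- `logDerivRatio G` is the quotient of `dw / w` by `dX / X`. -/
theorem logDerivRatio_mul_dlog (G : R⟦X⟧) (hG : PowerSeries.constantCoeff G = 1) :
    (logDerivRatio G : LaurentSeries R) * dlog (changeVar G) = dlog PowerSeries.X := by
  have h1 : PowerSeries.X * logDerivRatio G * PowerSeries.derivative R (changeVar G) =
      changeVar G := by
    have h := PowerSeries.mul_invOfUnit (PowerSeries.derivative R (changeVar G)) 1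
      (by simpa using constantCoeff_derivative_changeVar G)
    rw [logDerivRatio, ← mul_assoc, mul_assoc, mul_comm _ (PowerSeries.derivative R _), h, mul_one,
      changeVar]
  have h2 := congrArg (fun f : R⟦X⟧ => (f : LaurentSeries R)) h1
  simp only [PowerSeries.coe_mul] at h2
  have h3 := Ring.mul_inverse_cancel _ (isUnit_coe_changeVar G hG)
  have h4 := Ring.mul_inverse_cancel _ (isUnit_coe_X (R := R))
  apply (isUnit_coe_X (R := R)).mul_left_cancel
  rw [dlog, dlog, PowerSeries.derivative_X, PowerSeries.coe_one, one_mul, h4, ← mul_assoc,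
    ← mul_assoc, h2, h3]

end Checks

/-! At `(0_γ, γ)` a product with first factor `(0_α, α)` can only come from `(0_β, β)` with `α * β =
γ` and `β` on a geodesic from the identity to `γ`: the rank inequality `Setoid.card_quotient_add_le`
turns the colength condition into two equalities (`ofPerm_mul_eq_some_iff`). With `γ` an `n`-cycle
and `κ` the dual-number values of `♭φ^∨` on full cycles, the convolution by `ζ` is therefore the
free moment-cumulant sum of `∏ κ (cycle lengths of β)` over such `β`.

This sum is computed by deleting a point, keeping a counter `s` of the points already deleted from
the marked cycle of `β`. Each deletion splits a cycle of `γ` in two, and the outcome is the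
recursion `w_s = κ_s + X w_0 w_{s+1}` (`markedSum_eq`, `cumulant_conv_zeta`).

After `X = w / G(w)` the genus `0` part of the recursion is solved by the shifted series `∑ κ_{s+n}
w^n`, giving `G_{0,1}`; the `ħ`-part is its linearisation, whose solution carries the factor `1 / (G
dX/dw) = P^∨` (`subst_changeVar_eq_mk`, `subst_changeVar_tangent`). -/

/-! ### Partitions and the rank inequality -/

theorem Equiv.Perm.sameCycle_setoid_le {V : Type*} {σ : Equiv.Perm V} {r : Setoid V}
    (h : ∀ x, r x (σ x)) : Equiv.Perm.SameCycle.setoid σ ≤ r := by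
  rintro x y ⟨i, rfl⟩
  induction i using Int.induction_on with
  | zero => exact r.refl _
  | succ i ih =>
    rw [add_comm, zpow_add, zpow_one, Equiv.Perm.mul_apply]
    exact r.trans ih (h _)
  | pred i ih =>
    refine r.trans ih (r.symm ?_)
    have h := h ((σ ^ (-(i : ℤ) - 1)) x)
    rwa [← Equiv.Perm.mul_apply, ← zpow_one_add, add_sub_cancel] at h

/-- The functions that are constant on the classes of an equivalence relation. -/
def Setoid.constOn {V : Type*} (r : Setoid V) : Submodule ℚ (V → ℚ) :=
  LinearMap.range (LinearMap.funLeft ℚ ℚ (Quotient.mk r))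

theorem Setoid.mem_constOn {V : Type*} {r : Setoid V} {f : V → ℚ} :
    f ∈ r.constOn ↔ r ≤ Setoid.ker f := by
  constructor
  · rintro ⟨g, rfl⟩ x y h
    exact congrArg g (Quotient.sound h)
  · intro h
    exact ⟨Quotient.lift f fun _ _ hab => h hab, rfl⟩

theorem Setoid.finrank_constOn {V : Type*} [Finite V] (r : Setoid V) :
    Module.finrank ℚ r.constOn = Nat.card (Quotient r) := by
  have := Fintype.ofFinite (Quotient r)
  rw [Setoid.constOn, LinearMap.finrank_range_of_inj
    (LinearMap.funLeft_injective_of_surjective _ _ _ Quotient.mk_surjective)]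
  simp

/-- The number of classes is the dimension of `constOn`, and a function constant on the classes of
both `r` and `s` is constant on those of `r ⊔ s`; the claim is then the dimension formula for a sum
of subspaces. -/
theorem Setoid.card_quotient_add_le {V : Type*} [Finite V] (r s : Setoid V) :
    Nat.card (Quotient r) + Nat.card (Quotient s) ≤ Nat.card V + Nat.card (Quotient (r ⊔ s)) := by
  have := Fintype.ofFinite V
  have h1 : r.constOn ⊓ s.constOn ≤ (r ⊔ s).constOn := by
    rintro f ⟨hr, hs⟩
    exact Setoid.mem_constOn.2 (sup_le (Setoid.mem_constOn.1 hr) (Setoid.mem_constOn.1 hs))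
  have h2 := Submodule.finrank_sup_add_finrank_inf_eq r.constOn s.constOn
  have h3 := Submodule.finrank_mono h1
  have h4 := Submodule.finrank_le (r.constOn ⊔ s.constOn)
  simp only [Setoid.finrank_constOn, Module.finrank_fintype_fun_eq_card] at h2 h3 h4
  rw [Nat.card_eq_fintype_card (α := V)]
  omega

theorem Setoid.card_quotient_le {V : Type*} [Finite V] {r s : Setoid V} (h : r ≤ s) :
    Nat.card (Quotient s) ≤ Nat.card (Quotient r) :=
  Nat.card_le_card_of_surjective (Quotient.map id fun _ _ hab => h hab) fun q =>
    Quotient.inductionOn q fun x => ⟨Quotient.mk r x, rfl⟩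

theorem Setoid.eq_of_le_of_card_quotient_le {V : Type*} [Finite V] {r s : Setoid V} (h : r ≤ s)
    (hc : Nat.card (Quotient r) ≤ Nat.card (Quotient s)) : r = s := by
  refine le_antisymm h fun x y hxy => ?_
  have hs : Function.Surjective (Quotient.map id fun _ _ hab => h hab : Quotient r → Quotient s) :=
    fun q => Quotient.inductionOn q fun x => ⟨Quotient.mk r x, rfl⟩
  have hi := (hs.bijective_of_nat_card_le hc).1
  exact Quotient.exact (hi (show Quotient.mk s x = Quotient.mk s y from Quotient.sound hxy))

/-! ### Geodesics in the Cayley graph of transpositions -/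

namespace Equiv.Perm

variable {V : Type*}

/-- The number of cycles of a permutation, fixed points included. -/
noncomputable def numCycles (σ : Equiv.Perm V) : ℕ := Nat.card (Quotient (SameCycle.setoid σ))

theorem sameCycle_setoid_mul_le (σ τ : Equiv.Perm V) :
    SameCycle.setoid (σ * τ) ≤ SameCycle.setoid σ ⊔ SameCycle.setoid τ :=
  sameCycle_setoid_le fun x => (SameCycle.setoid σ ⊔ SameCycle.setoid τ).trans
    ((le_sup_right : _ ≤ SameCycle.setoid σ ⊔ SameCycle.setoid τ)
      (show SameCycle τ x (τ x) from ⟨1, by simp⟩))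
    ((le_sup_left : _ ≤ SameCycle.setoid σ ⊔ SameCycle.setoid τ)
      (show SameCycle σ (τ x) (σ (τ x)) from ⟨1, by simp⟩))

/-- `β` lies on a geodesic from the identity to `γ` in the Cayley graph of transpositions. -/
def IsGeodesic (γ β : Equiv.Perm V) : Prop :=
  (γ * β⁻¹).numCycles + β.numCycles = γ.numCycles + Nat.card V

/-- The cycle partition of `γ` refines the join, and by the rank inequality the geodesic condition
gives the join at least as many classes. -/
theorem IsGeodesic.sup_eq [Finite V] {γ β : Equiv.Perm V} (h : IsGeodesic γ β) :
    SameCycle.setoid (γ * β⁻¹) ⊔ SameCycle.setoid β = SameCycle.setoid γ := by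
  have h1 := Setoid.card_quotient_add_le (SameCycle.setoid (γ * β⁻¹)) (SameCycle.setoid β)
  have h2 := sameCycle_setoid_mul_le (γ * β⁻¹) β
  rw [inv_mul_cancel_right] at h2
  refine (Setoid.eq_of_le_of_card_quotient_le h2 ?_).symm
  unfold IsGeodesic numCycles at h
  omega

theorem IsGeodesic.sameCycle [Finite V] {γ β : Equiv.Perm V} (h : IsGeodesic γ β) (x : V) :
    SameCycle γ x (β x) := by
  have h1 : SameCycle.setoid β ≤ SameCycle.setoid γ := h.sup_eq ▸ le_sup_right
  exact h1 (show SameCycle β x (β x) from ⟨1, by simp⟩)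

end Equiv.Perm

/-! ### Cycles as finite sets and their lengths -/

namespace Equiv.Perm

section CycleClasses

variable {V W : Type*}

theorem sameCycle_permCongr (e : V ≃ W) {σ : Equiv.Perm V} {x y : V} :
    SameCycle (e.permCongr σ) (e x) (e y) ↔ SameCycle σ x y := by
  constructor
  · intro h
    have h1 : SameCycle.setoid (e.permCongr σ) ≤ (SameCycle.setoid σ).comap e.symm :=
      sameCycle_setoid_le fun u => show SameCycle σ (e.symm u) (e.symm (e.permCongr σ u)) from
        ⟨1, by simp⟩
    have h2 : SameCycle σ (e.symm (e x)) (e.symm (e y)) := h1 h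
    simpa using h2
  · intro h
    have h1 : SameCycle.setoid σ ≤ (SameCycle.setoid (e.permCongr σ)).comap e :=
      sameCycle_setoid_le fun u => show SameCycle (e.permCongr σ) (e u) (e (σ u)) from
        ⟨1, by simp⟩
    exact h1 h

theorem sameCycle_optionCongr {σ : Equiv.Perm V} {a b : V} :
    SameCycle (optionCongr σ) (some a) (some b) ↔ SameCycle σ a b := by
  constructor
  · intro h
    have h1 : SameCycle.setoid (optionCongr σ) ≤
        (SameCycle.setoid σ).comap fun u => u.getD a := sameCycle_setoid_le fun u => by
      rcases u with _ | u
      · exact SameCycle.refl σ _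
      · exact ⟨1, by simp⟩
    exact h1 h
  · intro h
    have h1 : SameCycle.setoid σ ≤ (SameCycle.setoid (optionCongr σ)).comap some :=
      sameCycle_setoid_le fun u => show SameCycle (optionCongr σ) (some u) (some (σ u)) from
        ⟨1, by simp⟩
    exact h1 h

theorem not_sameCycle_optionCongr {σ : Equiv.Perm V} {b : V} :
    ¬ SameCycle (optionCongr σ) none (some b) := fun h =>
  nomatch h.eq_of_left (show optionCongr σ none = none by simp)

/-- The product inserts `none` just before `x` in its cycle; `getD x` collapses the new point onto
`x`. -/
theorem sameCycle_insert_iff [DecidableEq V] {σ : Equiv.Perm V} {x : V} {u v : Option V} :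
    SameCycle (swap none (some x) * optionCongr σ) u v ↔ SameCycle σ (u.getD x) (v.getD x) := by
  have hn : (swap none (some x) * optionCongr σ) none = some x := by simp
  constructor
  · intro h
    have h1 : SameCycle.setoid (swap none (some x) * optionCongr σ) ≤
        (SameCycle.setoid σ).comap fun u => u.getD x := sameCycle_setoid_le fun u => by
      rcases u with _ | u
      · rw [hn]
        exact SameCycle.refl σ x
      · refine ⟨1, ?_⟩
        by_cases hu : σ u = x
        · simp [hu]
        · simp [swap_apply_of_ne_of_ne (a := none) (b := some x) (x := some (σ u)) (by simp)
            (by simpa using hu)]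
    exact h1 h
  · intro h
    have h0 : ∀ u : Option V,
        SameCycle (swap none (some x) * optionCongr σ) u (some (u.getD x)) := by
      rintro (_ | u)
      · exact ⟨1, by simp⟩
      · exact SameCycle.refl _ _
    have h1 : SameCycle.setoid σ ≤
        (SameCycle.setoid (swap none (some x) * optionCongr σ)).comap some :=
      sameCycle_setoid_le fun u => by
        change SameCycle _ _ _
        by_cases hu : σ u = x
        · exact (show SameCycle _ (some u) none from ⟨1, by simp [hu]⟩).trans ⟨1, by simp [hu]⟩
        · refine ⟨1, ?_⟩
          simp [swap_apply_of_ne_of_ne (a := none) (b := some x) (x := some (σ u)) (by simp)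
            (by simpa using hu)]
    exact (h0 u).trans ((show SameCycle _ _ _ from h1 h).trans (h0 v).symm)

variable [Fintype V] [Fintype W]

open Classical in
/-- The cycle through a point, as a finite set. -/
noncomputable def cycleClass (σ : Equiv.Perm V) (v : V) : Finset V :=
  Finset.univ.filter (SameCycle σ v)

open Classical in
/-- The cycles of a permutation, as finite sets; fixed points are included. -/
noncomputable def cycleClasses (σ : Equiv.Perm V) : Finset (Finset V) :=
  Finset.univ.image (cycleClass σ)

/-- The length of the cycle through a point. -/
noncomputable def cycleLen (σ : Equiv.Perm V) (v : V) : ℕ := (cycleClass σ v).card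

open Classical in
/-- The cycles that avoid a point. -/
noncomputable def otherClasses (σ : Equiv.Perm V) (v : V) : Finset (Finset V) :=
  (cycleClasses σ).filter fun c => v ∉ c

/-- The lengths of the cycles that avoid a point. -/
noncomputable def otherLens (σ : Equiv.Perm V) (v : V) : Multiset ℕ :=
  (otherClasses σ v).val.map Finset.card

/-- The lengths of all cycles. -/
noncomputable def allLens (σ : Equiv.Perm V) : Multiset ℕ :=
  (cycleClasses σ).val.map Finset.card

@[simp]
theorem mem_cycleClass {σ : Equiv.Perm V} {v w : V} : w ∈ cycleClass σ v ↔ SameCycle σ v w := by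
  simp [cycleClass]

theorem mem_cycleClasses {σ : Equiv.Perm V} {c : Finset V} :
    c ∈ cycleClasses σ ↔ ∃ v, cycleClass σ v = c := by
  simp [cycleClasses]

theorem mem_otherClasses {σ : Equiv.Perm V} {v : V} {c : Finset V} :
    c ∈ otherClasses σ v ↔ ∃ w, ¬ SameCycle σ v w ∧ cycleClass σ w = c := by
  simp only [otherClasses, Finset.mem_filter, mem_cycleClasses]
  constructor
  · rintro ⟨⟨w, rfl⟩, h⟩
    exact ⟨w, fun h' => h (mem_cycleClass.2 h'.symm), rfl⟩
  · rintro ⟨w, h, rfl⟩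
    exact ⟨⟨w, rfl⟩, fun h' => h (mem_cycleClass.1 h').symm⟩

theorem cycleClass_eq_iff {σ : Equiv.Perm V} {v w : V} :
    cycleClass σ v = cycleClass σ w ↔ SameCycle σ v w := by
  constructor
  · intro h
    exact mem_cycleClass.1 (h ▸ mem_cycleClass.2 (SameCycle.refl σ w))
  · intro h
    ext u
    rw [mem_cycleClass, mem_cycleClass]
    exact ⟨h.symm.trans, h.trans⟩

theorem allLens_eq_cons (σ : Equiv.Perm V) (v : V) :
    allLens σ = cycleLen σ v ::ₘ otherLens σ v := by
  classical
  have h : cycleClass σ v ∉ otherClasses σ v := fun h =>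
    (Finset.mem_filter.1 h).2 (mem_cycleClass.2 (SameCycle.refl σ v))
  have h2 : cycleClasses σ = Finset.cons (cycleClass σ v) (otherClasses σ v) h := by
    ext c
    rw [Finset.mem_cons, mem_cycleClasses, mem_otherClasses]
    constructor
    · rintro ⟨w, rfl⟩
      rw [cycleClass_eq_iff]
      by_cases hw : SameCycle σ v w
      · exact Or.inl hw.symm
      · exact Or.inr ⟨w, hw, rfl⟩
    · rintro (rfl | ⟨w, -, rfl⟩)
      exacts [⟨v, rfl⟩, ⟨w, rfl⟩]
  rw [allLens, h2, Finset.cons_val, Multiset.map_cons]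
  rfl

theorem allLens_of_isEmpty [IsEmpty V] (σ : Equiv.Perm V) : allLens σ = 0 := by
  simp [allLens, cycleClasses, Finset.univ_eq_empty]

-- The product in `IsMultiplicative` runs over a quotient; this converts it into a product over
-- cycle lengths.
open Classical in
theorem map_card_quotient (σ : Equiv.Perm V) :
    (Finset.univ : Finset (Quotient (SameCycle.setoid σ))).val.map
      (fun A => Nat.card {x // Quotient.mk (SameCycle.setoid σ) x = A}) = allLens σ := by
  let f : Quotient (SameCycle.setoid σ) → Finset V := fun A =>
    Finset.univ.filter fun x => Quotient.mk (SameCycle.setoid σ) x = A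
  have hf : ∀ v, f (Quotient.mk _ v) = cycleClass σ v := fun v => by
    ext w
    rw [mem_cycleClass, Finset.mem_filter]
    simp only [Finset.mem_univ, true_and]
    rw [Quotient.eq, sameCycle_comm]
    rfl
  have hi : Function.Injective f := by
    intro A B
    refine Quotient.inductionOn₂ A B fun a b h => ?_
    rw [hf, hf, cycleClass_eq_iff] at h
    exact Quotient.sound h
  have h : cycleClasses σ = Finset.univ.map ⟨f, hi⟩ := by
    ext c
    rw [mem_cycleClasses, Finset.mem_map]
    constructor
    · rintro ⟨v, rfl⟩
      exact ⟨Quotient.mk _ v, Finset.mem_univ _, hf v⟩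
    · rintro ⟨A, -, rfl⟩
      refine Quotient.inductionOn A fun v => ⟨v, (hf v).symm⟩
  rw [allLens, h, Finset.map_val, Multiset.map_map]
  refine Multiset.map_congr rfl fun A _ => ?_
  rw [Nat.card_eq_fintype_card, Fintype.card_subtype]
  rfl

theorem numCycles_eq (σ : Equiv.Perm V) : numCycles σ = Multiset.card (allLens σ) := by
  classical
  rw [← map_card_quotient, Multiset.card_map, numCycles, Nat.card_eq_fintype_card]
  rfl

theorem numCycles_eq_add_one (σ : Equiv.Perm V) (v : V) :
    numCycles σ = Multiset.card (otherLens σ v) + 1 := by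
  rw [numCycles_eq, allLens_eq_cons σ v, Multiset.card_cons]

theorem cycleClass_permCongr (e : V ≃ W) (σ : Equiv.Perm V) (v : V) :
    cycleClass (e.permCongr σ) (e v) = (cycleClass σ v).map e.toEmbedding := by
  ext w
  obtain ⟨u, rfl⟩ := e.surjective w
  rw [mem_cycleClass, sameCycle_permCongr, ← mem_cycleClass]
  simp

theorem cycleLen_permCongr (e : V ≃ W) (σ : Equiv.Perm V) (v : V) :
    cycleLen (e.permCongr σ) (e v) = cycleLen σ v := by
  rw [cycleLen, cycleClass_permCongr, Finset.card_map]
  rfl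

theorem otherLens_permCongr (e : V ≃ W) (σ : Equiv.Perm V) (v : V) :
    otherLens (e.permCongr σ) (e v) = otherLens σ v := by
  have h : otherClasses (e.permCongr σ) (e v) =
      (otherClasses σ v).map (Finset.mapEmbedding e.toEmbedding).toEmbedding := by
    ext c
    rw [Finset.mem_map]
    simp only [mem_otherClasses, e.surjective.exists, sameCycle_permCongr, cycleClass_permCongr]
    constructor
    · rintro ⟨w, hw, rfl⟩
      exact ⟨_, ⟨w, hw, rfl⟩, rfl⟩
    · rintro ⟨_, ⟨w, hw, rfl⟩, rfl⟩
      exact ⟨w, hw, rfl⟩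
  rw [otherLens, h, Finset.map_val, Multiset.map_map]
  exact Multiset.map_congr rfl fun c _ => Finset.card_map _

theorem allLens_permCongr (e : V ≃ W) (σ : Equiv.Perm V) :
    allLens (e.permCongr σ) = allLens σ := by
  rcases isEmpty_or_nonempty V with h | ⟨⟨v⟩⟩
  · have := e.symm.isEmpty
    rw [allLens_of_isEmpty, allLens_of_isEmpty]
  · rw [allLens_eq_cons _ (e v), allLens_eq_cons σ v, cycleLen_permCongr, otherLens_permCongr]

theorem numCycles_permCongr (e : V ≃ W) (σ : Equiv.Perm V) :
    numCycles (e.permCongr σ) = numCycles σ := by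
  rw [numCycles_eq, numCycles_eq, allLens_permCongr]

theorem numCycles_conj (σ τ : Equiv.Perm V) : numCycles (τ * σ * τ⁻¹) = numCycles σ :=
  numCycles_permCongr τ σ

end CycleClasses

/-! ### Adding one point to a permutation -/

section Insert

variable {V : Type*} [Fintype V]

theorem cycleClass_optionCongr (σ : Equiv.Perm V) (a : V) :
    cycleClass (optionCongr σ) (some a) = (cycleClass σ a).map Function.Embedding.some := by
  ext u
  rcases u with _ | u
  · simp [sameCycle_comm, not_sameCycle_optionCongr]
  · simp [sameCycle_optionCongr]

theorem cycleLen_optionCongr_none (σ : Equiv.Perm V) : cycleLen (optionCongr σ) none = 1 := by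
  rw [cycleLen, Finset.card_eq_one]
  refine ⟨none, Finset.ext fun u => ?_⟩
  rcases u with _ | u
  · simp [SameCycle.refl]
  · simp [not_sameCycle_optionCongr]

theorem otherLens_optionCongr_none (σ : Equiv.Perm V) :
    otherLens (optionCongr σ) none = allLens σ := by
  have h : otherClasses (optionCongr σ) none =
      (cycleClasses σ).map (Finset.mapEmbedding Function.Embedding.some).toEmbedding := by
    ext c
    rw [Finset.mem_map, mem_otherClasses]
    simp only [mem_cycleClasses]
    constructor
    · rintro ⟨_ | w, hw, rfl⟩
      · exact absurd (SameCycle.refl _ _) hw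
      · exact ⟨_, ⟨w, rfl⟩, (cycleClass_optionCongr σ w).symm⟩
    · rintro ⟨_, ⟨w, rfl⟩, rfl⟩
      exact ⟨some w, not_sameCycle_optionCongr, cycleClass_optionCongr σ w⟩
  rw [otherLens, h, Finset.map_val, Multiset.map_map]
  exact Multiset.map_congr rfl fun c _ => Finset.card_map _

theorem numCycles_optionCongr (σ : Equiv.Perm V) :
    numCycles (optionCongr σ) = numCycles σ + 1 := by
  rw [numCycles_eq_add_one _ none, otherLens_optionCongr_none, numCycles_eq]

variable [DecidableEq V]

theorem cycleLen_insert (σ : Equiv.Perm V) (x : V) :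
    cycleLen (swap none (some x) * optionCongr σ) none = cycleLen σ x + 1 := by
  have h : cycleClass (swap none (some x) * optionCongr σ) none =
      (cycleClass σ x).insertNone := by
    ext u
    rcases u with _ | u <;> simp [sameCycle_insert_iff, SameCycle.refl]
  rw [cycleLen, h, Finset.card_insertNone]
  rfl

theorem otherLens_insert (σ : Equiv.Perm V) (x : V) :
    otherLens (swap none (some x) * optionCongr σ) none = otherLens σ x := by
  have h0 : ∀ w, ¬ SameCycle σ x w → cycleClass (swap none (some x) * optionCongr σ) (some w) =
      (cycleClass σ w).map Function.Embedding.some := by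
    intro w hw
    ext u
    rcases u with _ | u
    · simpa [sameCycle_insert_iff, sameCycle_comm (x := w)] using hw
    · simp [sameCycle_insert_iff]
  have h : otherClasses (swap none (some x) * optionCongr σ) none =
      (otherClasses σ x).map (Finset.mapEmbedding Function.Embedding.some).toEmbedding := by
    ext c
    rw [Finset.mem_map]
    simp only [mem_otherClasses, sameCycle_insert_iff]
    constructor
    · rintro ⟨_ | w, hw, rfl⟩
      · exact absurd (SameCycle.refl _ _) hw
      · exact ⟨_, ⟨w, hw, rfl⟩, (h0 w hw).symm⟩
    · rintro ⟨_, ⟨w, hw, rfl⟩, rfl⟩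
      exact ⟨some w, hw, h0 w hw⟩
  rw [otherLens, h, Finset.map_val, Multiset.map_map]
  exact Multiset.map_congr rfl fun c _ => Finset.card_map _

theorem numCycles_insert (σ : Equiv.Perm V) (x : V) :
    numCycles (swap none (some x) * optionCongr σ) = numCycles σ := by
  rw [numCycles_eq_add_one _ none, otherLens_insert, ← numCycles_eq_add_one]

end Insert

end Equiv.Perm

/-! ### Orbits, and splitting a cycle by a transposition -/

namespace Equiv.Perm

variable {V : Type*}

theorem pow_minimalPeriod_apply (σ : Equiv.Perm V) (x : V) :
    (σ ^ Function.minimalPeriod σ x) x = x := by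
  rw [← iterate_eq_pow]
  exact Function.iterate_minimalPeriod

theorem pow_apply_injOn (σ : Equiv.Perm V) (x : V) :
    Set.InjOn (fun n : ℕ => (σ ^ n) x) (Finset.range (Function.minimalPeriod σ x)) := by
  intro m hm n hn h
  simp only [← iterate_eq_pow] at h
  exact (Function.iterate_eq_iterate_iff_of_lt_minimalPeriod (by simpa using hm)
    (by simpa using hn)).1 h

variable [Fintype V]

/-- On a finite set every point of a cycle is reached by natural powers, so forward invariance
suffices. -/
theorem cycleClass_eq_of_invariant {σ : Equiv.Perm V} {v : V} {s : Finset V}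
    (hs : ∀ y ∈ s, σ y ∈ s) (hv : v ∈ s) (h : ∀ y ∈ s, SameCycle σ v y) : cycleClass σ v = s := by
  ext y
  rw [mem_cycleClass]
  refine ⟨fun hy => ?_, h y⟩
  obtain ⟨n, rfl⟩ := hy.exists_nat_pow_eq
  clear hy
  induction n with
  | zero => exact hv
  | succ n ih =>
    rw [pow_succ']
    exact hs _ ih

theorem cycleClass_congr {σ τ : Equiv.Perm V} {v : V} (h : ∀ y ∈ cycleClass σ v, τ y = σ y) :
    cycleClass τ v = cycleClass σ v := by
  have h1 : ∀ n : ℕ, (τ ^ n) v = (σ ^ n) v := by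
    intro n
    induction n with
    | zero => rfl
    | succ n ih =>
      rw [pow_succ', pow_succ', mul_apply, mul_apply, ih, h]
      exact mem_cycleClass.2 ⟨n, by simp⟩
  refine cycleClass_eq_of_invariant (fun y hy => ?_) (mem_cycleClass.2 (SameCycle.refl σ v))
    fun y hy => ?_
  · rw [h y hy]
    exact mem_cycleClass.2 (sameCycle_apply_right.2 (mem_cycleClass.1 hy))
  · obtain ⟨n, rfl⟩ := (mem_cycleClass.1 hy).exists_nat_pow_eq
    exact ⟨n, by simp [h1]⟩

theorem minimalPeriod_pos (σ : Equiv.Perm V) (x : V) : 0 < Function.minimalPeriod σ x :=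
  Function.minimalPeriod_pos_of_mem_periodicPts
    ((Function.Injective.mem_periodicPts σ.injective x))

variable [DecidableEq V]

theorem cycleClass_eq_image (σ : Equiv.Perm V) (x : V) :
    cycleClass σ x =
      (Finset.range (Function.minimalPeriod σ x)).image fun n : ℕ => (σ ^ n) x := by
  refine cycleClass_eq_of_invariant ?_ ?_ ?_
  · simp only [Finset.mem_image, Finset.mem_range]
    rintro _ ⟨n, hn, rfl⟩
    rcases Nat.lt_or_ge (n + 1) (Function.minimalPeriod σ x) with h | h
    · exact ⟨n + 1, h, by rw [pow_succ', mul_apply]⟩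
    · refine ⟨0, minimalPeriod_pos σ x, ?_⟩
      rw [← mul_apply, ← pow_succ', show n + 1 = Function.minimalPeriod σ x by omega,
        pow_minimalPeriod_apply]
      rfl
  · exact Finset.mem_image.2 ⟨0, by simpa using minimalPeriod_pos σ x, rfl⟩
  · simp only [Finset.mem_image]
    rintro _ ⟨n, -, rfl⟩
    exact ⟨n, by simp⟩

theorem cycleLen_eq_minimalPeriod (σ : Equiv.Perm V) (x : V) :
    cycleLen σ x = Function.minimalPeriod σ x := by
  rw [cycleLen, cycleClass_eq_image, Finset.card_image_of_injOn (pow_apply_injOn σ x),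
    Finset.card_range]

theorem eq_of_pow_apply_eq {σ : Equiv.Perm V} {x : V} {m n : ℕ} (hm : m < cycleLen σ x)
    (hn : n < cycleLen σ x) (h : (σ ^ m) x = (σ ^ n) x) : m = n := by
  classical
  rw [cycleLen_eq_minimalPeriod] at hm hn
  exact pow_apply_injOn σ x (by simpa using hm) (by simpa using hn) h

theorem sum_cycleClass {M : Type*} [AddCommMonoid M] (σ : Equiv.Perm V) (x : V) (f : V → M) :
    ∑ j ∈ cycleClass σ x, f j = ∑ i ∈ Finset.range (cycleLen σ x), f ((σ ^ i) x) := by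
  rw [cycleLen_eq_minimalPeriod, cycleClass_eq_image, Finset.sum_image (pow_apply_injOn σ x)]

section Split

variable {σ : Equiv.Perm V} {x : V} {i : ℕ}

/-- Left multiplication by the transposition only exchanges the arrows into `x` and into `σ ^ i x`.
For `0 < i` the cycle `(x, σ x, …)` is cut into the exponents `n < i` and the exponents `n ≥ i`. -/
theorem swap_mul_pow_apply (hi : i < cycleLen σ x) {n : ℕ} (hn : n + 1 ≠ i)
    (h : n + 1 < cycleLen σ x) :
    (swap x ((σ ^ i) x) * σ) ((σ ^ n) x) = (σ ^ (n + 1)) x := by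
  rw [mul_apply, ← mul_apply σ, ← pow_succ', swap_apply_of_ne_of_ne]
  · intro h1
    exact absurd (eq_of_pow_apply_eq (n := 0) h (by omega) h1) (by omega)
  · intro h1
    exact hn (eq_of_pow_apply_eq h hi h1)

theorem cycleClass_swap_mul_left (hi : i < cycleLen σ x) (h0 : 0 < i) :
    cycleClass (swap x ((σ ^ i) x) * σ) x =
      (Finset.range i).image fun n : ℕ => (σ ^ n) x := by
  refine cycleClass_eq_of_invariant ?_ (Finset.mem_image.2 ⟨0, by simpa using h0, rfl⟩) ?_
  · simp only [Finset.mem_image, Finset.mem_range]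
    rintro _ ⟨n, hn, rfl⟩
    rcases Nat.lt_or_ge (n + 1) i with h | h
    · exact ⟨n + 1, h, (swap_mul_pow_apply hi h.ne (by omega)).symm⟩
    · refine ⟨0, h0, ?_⟩
      rw [mul_apply, ← mul_apply σ, ← pow_succ', show n + 1 = i by omega, swap_apply_right]
      rfl
  · simp only [Finset.mem_image, Finset.mem_range]
    rintro _ ⟨n, hn, rfl⟩
    induction n with
    | zero => exact SameCycle.refl _ _
    | succ n ih =>
      rw [← swap_mul_pow_apply hi hn.ne (by omega), sameCycle_apply_right]
      exact ih (by omega)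

theorem cycleClass_swap_mul_right (hi : i < cycleLen σ x) :
    cycleClass (swap x ((σ ^ i) x) * σ) ((σ ^ i) x) =
      (Finset.Ico i (cycleLen σ x)).image fun n : ℕ => (σ ^ n) x := by
  refine cycleClass_eq_of_invariant ?_ (Finset.mem_image.2 ⟨i, by simpa using hi, rfl⟩) ?_
  · simp only [Finset.mem_image, Finset.mem_Ico]
    rintro _ ⟨n, hn, rfl⟩
    rcases Nat.lt_or_ge (n + 1) (cycleLen σ x) with h | h
    · exact ⟨n + 1, by omega, (swap_mul_pow_apply hi (by omega) h).symm⟩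
    · refine ⟨i, by omega, ?_⟩
      rw [mul_apply, ← mul_apply σ, ← pow_succ', show n + 1 = cycleLen σ x by omega,
        cycleLen_eq_minimalPeriod, pow_minimalPeriod_apply, swap_apply_left]
  · simp only [Finset.mem_image, Finset.mem_Ico]
    rintro _ ⟨n, ⟨hn, hn'⟩, rfl⟩
    induction n, hn using Nat.le_induction with
    | base => exact SameCycle.refl _ _
    | succ n hn ih =>
      rw [← swap_mul_pow_apply hi (by omega) hn', sameCycle_apply_right]
      exact ih (by omega)

theorem cycleLen_swap_mul (hi : i < cycleLen σ x) :
    cycleLen (swap x ((σ ^ i) x) * σ) ((σ ^ i) x) = cycleLen σ x - i := by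
  rw [cycleLen, cycleClass_swap_mul_right hi, Finset.card_image_of_injOn, Nat.card_Ico]
  refine (pow_apply_injOn σ x).mono fun n hn => ?_
  rw [← cycleLen_eq_minimalPeriod]
  simp only [Finset.coe_Ico, Set.mem_Ico] at hn
  simpa using hn.2

theorem cycleClass_swap_mul_of_not_sameCycle {w : V} (hw : ¬ SameCycle σ x w) :
    cycleClass (swap x ((σ ^ i) x) * σ) w = cycleClass σ w := by
  refine cycleClass_congr fun y hy => ?_
  rw [mem_cycleClass] at hy
  rw [mul_apply, swap_apply_of_ne_of_ne]
  · rintro rfl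
    exact hw (sameCycle_apply_left.2 hy.symm)
  · intro h
    refine hw (hy.trans (SameCycle.trans (y := σ y) ⟨1, by simp⟩ ?_)).symm
    rw [h]
    exact sameCycle_pow_left.2 (SameCycle.refl _ _)

theorem otherLens_swap_mul (hi : i < cycleLen σ x) (h0 : 0 < i) :
    otherLens (swap x ((σ ^ i) x) * σ) ((σ ^ i) x) = i ::ₘ otherLens σ x := by
  have hA : cycleClass (swap x ((σ ^ i) x) * σ) x ∉ otherClasses σ x := by
    rw [mem_otherClasses]
    rintro ⟨w, hw, h⟩
    exact hw (mem_cycleClass.1 (h ▸ mem_cycleClass.2 (SameCycle.refl _ _))).symm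
  have hp : ∀ w, SameCycle σ x w →
      SameCycle (swap x ((σ ^ i) x) * σ) x w ∨
        SameCycle (swap x ((σ ^ i) x) * σ) ((σ ^ i) x) w := by
    intro w hw
    rw [← mem_cycleClass, ← mem_cycleClass, cycleClass_swap_mul_left hi h0,
      cycleClass_swap_mul_right hi]
    rw [← mem_cycleClass, cycleClass_eq_image, ← cycleLen_eq_minimalPeriod] at hw
    simp only [Finset.mem_image, Finset.mem_range, Finset.mem_Ico] at hw ⊢
    obtain ⟨n, hn, rfl⟩ := hw
    rcases Nat.lt_or_ge n i with h | h
    · exact Or.inl ⟨n, h, rfl⟩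
    · exact Or.inr ⟨n, ⟨h, hn⟩, rfl⟩
  have hd : ¬ SameCycle (swap x ((σ ^ i) x) * σ) ((σ ^ i) x) x := by
    rw [← mem_cycleClass, cycleClass_swap_mul_right hi]
    simp only [Finset.mem_image, Finset.mem_Ico]
    rintro ⟨n, hn, h⟩
    exact absurd (eq_of_pow_apply_eq (n := 0) hn.2 (by omega) h) (by omega)
  have hd' : ∀ w, ¬ SameCycle σ x w → ¬ SameCycle (swap x ((σ ^ i) x) * σ) ((σ ^ i) x) w := by
    intro w hw h
    rw [sameCycle_comm, ← mem_cycleClass, cycleClass_swap_mul_of_not_sameCycle hw,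
      mem_cycleClass, sameCycle_pow_right] at h
    exact hw h.symm
  have h : otherClasses (swap x ((σ ^ i) x) * σ) ((σ ^ i) x) =
      Finset.cons (cycleClass (swap x ((σ ^ i) x) * σ) x) (otherClasses σ x) hA := by
    ext c
    rw [Finset.mem_cons, mem_otherClasses, mem_otherClasses]
    constructor
    · rintro ⟨w, hw, rfl⟩
      by_cases hxw : SameCycle σ x w
      · exact Or.inl (cycleClass_eq_iff.2 ((hp w hxw).resolve_right hw).symm)
      · exact Or.inr ⟨w, hxw, (cycleClass_swap_mul_of_not_sameCycle hxw).symm⟩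
    · rintro (rfl | ⟨w, hw, rfl⟩)
      · exact ⟨x, hd, rfl⟩
      · exact ⟨w, hd' w hw, cycleClass_swap_mul_of_not_sameCycle hw⟩
  rw [otherLens, h, Finset.cons_val, Multiset.map_cons, cycleClass_swap_mul_left hi h0,
    Finset.card_image_of_injOn, Finset.card_range]
  · rfl
  · refine (pow_apply_injOn σ x).mono fun n hn => ?_
    rw [← cycleLen_eq_minimalPeriod]
    simp only [Finset.coe_range, Set.mem_Iio] at hn ⊢
    omega

theorem numCycles_swap_mul {j : V} (h : SameCycle σ x j) (hj : j ≠ x) :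
    numCycles (swap x j * σ) = numCycles σ + 1 := by
  rw [← mem_cycleClass, cycleClass_eq_image, ← cycleLen_eq_minimalPeriod] at h
  simp only [Finset.mem_image, Finset.mem_range] at h
  obtain ⟨i, hi, rfl⟩ := h
  have h0 : 0 < i := Nat.pos_of_ne_zero fun h => hj (by simp [h])
  rw [numCycles_eq_add_one _ ((σ ^ i) x), numCycles_eq_add_one σ x, otherLens_swap_mul hi h0,
    Multiset.card_cons]

end Split

end Equiv.Perm

/-! ### Geodesics under deletion of a point -/

namespace Equiv.Perm

section Geodesic

variable {V W : Type*}

theorem optionCongr_mul (σ τ : Equiv.Perm V) :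
    optionCongr (σ * τ) = optionCongr σ * optionCongr τ := by
  ext1 x
  cases x <;> simp

theorem optionCongr_inv (σ : Equiv.Perm V) : optionCongr σ⁻¹ = (optionCongr σ)⁻¹ := rfl

variable [Fintype V] [Fintype W]

theorem isGeodesic_permCongr (e : V ≃ W) {γ β : Equiv.Perm V} :
    IsGeodesic (e.permCongr γ) (e.permCongr β) ↔ IsGeodesic γ β := by
  have h : e.permCongr γ * (e.permCongr β)⁻¹ = e.permCongr (γ * β⁻¹) := by
    rw [eq_comm, eq_mul_inv_iff_mul_eq]
    ext x
    simp [mul_apply]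
  rw [IsGeodesic, IsGeodesic, h, numCycles_permCongr, numCycles_permCongr, numCycles_permCongr,
    Nat.card_congr e]

variable [DecidableEq V]

/-- A fixed point of `β` can be deleted from both permutations: both sides of the defining equation
drop by the same amount. -/
theorem isGeodesic_optionCongr {γ β : Equiv.Perm V} {y : Option V} :
    IsGeodesic (swap none y * optionCongr γ) (optionCongr β) ↔ IsGeodesic γ β := by
  rw [IsGeodesic, IsGeodesic, mul_assoc, ← optionCongr_inv, ← optionCongr_mul,
    numCycles_optionCongr, Nat.card_eq_fintype_card, Nat.card_eq_fintype_card,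
    Fintype.card_option]
  rcases y with _ | y
  · rw [swap_self, ← one_def, one_mul, one_mul, numCycles_optionCongr, numCycles_optionCongr]
    omega
  · rw [numCycles_insert, numCycles_insert]
    omega

/-- Conjugation by `(none j)` moves the transposition of `β` to the left, and `(none j)(none x) =
(none x)(x j)`; up to the inserted point, `γ * β⁻¹` has become `(x j) * γ * β⁻¹`. If `j ≠ x`, the
extra cycle of `(x j) * γ` balances the extra point; if `j = x`, the fixed point `none` does. -/
theorem isGeodesic_insert {γ β : Equiv.Perm V} {x j : V} (h : SameCycle γ x j) :
    IsGeodesic (swap none (some x) * optionCongr γ) (swap none (some j) * optionCongr β) ↔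
      IsGeodesic (swap x j * γ) β := by
  have h1 : numCycles (swap none (some x) * optionCongr γ *
      (swap none (some j) * optionCongr β)⁻¹) = numCycles (swap none (some j) *
        swap none (some x) * optionCongr (γ * β⁻¹)) := by
    rw [← numCycles_conj _ (swap none (some j)), optionCongr_mul, optionCongr_inv]
    congr 1
    rw [mul_inv_rev, swap_inv]
    simp only [mul_assoc, swap_mul_self, mul_one]
  rw [IsGeodesic, IsGeodesic, h1, numCycles_insert, numCycles_insert, Nat.card_eq_fintype_card,
    Nat.card_eq_fintype_card, Fintype.card_option, mul_assoc (swap x j)]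
  by_cases hj : j = x
  · subst hj
    rw [swap_mul_self, one_mul, swap_self, ← one_def, one_mul, one_mul, numCycles_optionCongr]
    omega
  · have h2 : swap none (some j) * swap none (some x) =
        swap none (some x) * optionCongr (swap x j) := by
      rw [optionCongr_swap]
      ext1 u
      simp only [mul_apply, swap_apply_def]
      grind
    rw [h2, mul_assoc (swap none (some x)), ← optionCongr_mul, numCycles_insert,
      numCycles_swap_mul h hj]
    omega

end Geodesic

/-! ### Sums over geodesics -/

section Sums

variable {S : Type*} [CommRing S] (κ : ℕ → S)
variable {V W : Type*} [Fintype V] [Fintype W]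

/-- The product over the cycles of a function of their length. -/
noncomputable def cycleProd (σ : Equiv.Perm V) : S := ((allLens σ).map κ).prod

/-- The product over the cycles of a function of their length, where `s` is added to the length
of the cycle through `v`. -/
noncomputable def markedProd (s : ℕ) (σ : Equiv.Perm V) (v : V) : S :=
  κ (s + cycleLen σ v) * ((otherLens σ v).map κ).prod

open Classical in
/-- The sum of `cycleProd` over the permutations below `γ` in the absolute order. -/
noncomputable def geodesicSum (γ : Equiv.Perm V) : S :=
  ∑ᶠ β : Equiv.Perm V, if IsGeodesic γ β then cycleProd κ β else 0

open Classical in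
/-- The sum of `markedProd` over the permutations below `γ` in the absolute order. -/
noncomputable def markedSum (s : ℕ) (γ : Equiv.Perm V) (v : V) : S :=
  ∑ᶠ β : Equiv.Perm V, if IsGeodesic γ β then markedProd κ s β v else 0

theorem markedProd_zero (σ : Equiv.Perm V) (v : V) : markedProd κ 0 σ v = cycleProd κ σ := by
  rw [markedProd, cycleProd, allLens_eq_cons σ v, Multiset.map_cons, Multiset.prod_cons, zero_add]

theorem markedSum_zero (γ : Equiv.Perm V) (v : V) : markedSum κ 0 γ v = geodesicSum κ γ := by
  simp only [markedSum, geodesicSum, markedProd_zero]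

theorem geodesicSum_of_isEmpty [IsEmpty V] (γ : Equiv.Perm V) : geodesicSum κ γ = 1 := by
  have h : ∀ σ : Equiv.Perm V, numCycles σ = 0 := fun σ => by
    rw [numCycles_eq, allLens_of_isEmpty, Multiset.card_zero]
  simp [geodesicSum, finsum_unique, IsGeodesic, h, cycleProd, allLens_of_isEmpty]

theorem markedSum_permCongr (e : V ≃ W) (s : ℕ) (γ : Equiv.Perm V) (v : V) :
    markedSum κ s (e.permCongr γ) (e v) = markedSum κ s γ v := by
  symm
  unfold markedSum
  refine finsum_eq_of_bijective e.permCongr e.permCongr.bijective fun β => ?_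
  rw [markedProd, markedProd, cycleLen_permCongr, otherLens_permCongr]
  by_cases h : IsGeodesic γ β
  · rw [if_pos h, if_pos ((isGeodesic_permCongr e).2 h)]
  · rw [if_neg h, if_neg (mt (isGeodesic_permCongr e).1 h)]

variable [DecidableEq V]

theorem sum_perm_option {M : Type*} [AddCommMonoid M] (f : Equiv.Perm (Option V) → M) :
    ∑ β, f β = ∑ β, f (optionCongr β) + ∑ j : V, ∑ β, f (swap none (some j) * optionCongr β) := by
  rw [← decomposeOption.symm.sum_comp, Fintype.sum_prod_type, Fintype.sum_option]
  simp only [decomposeOption_symm_apply, swap_self, ← one_def, one_mul]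

theorem markedSum_optionCongr (s : ℕ) (γ : Equiv.Perm V) :
    markedSum κ s (optionCongr γ) none = κ (s + 1) * geodesicSum κ γ := by
  classical
  have h1 : ∀ (j : V) (β : Equiv.Perm V),
      ¬ IsGeodesic (optionCongr γ) (swap none (some j) * optionCongr β) := fun j β h => by
    have := h.sameCycle none
    simp [not_sameCycle_optionCongr] at this
  have h2 : ∀ β : Equiv.Perm V, IsGeodesic (optionCongr γ) (optionCongr β) ↔ IsGeodesic γ β :=
    fun β => by simpa [← one_def] using isGeodesic_optionCongr (γ := γ) (β := β) (y := none)
  simp only [markedSum, finsum_eq_sum_of_fintype, sum_perm_option, h1, h2, if_false, Finset.sum_const_zero, add_zero,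
    markedProd, cycleLen_optionCongr_none, otherLens_optionCongr_none, geodesicSum, cycleProd,
    Finset.mul_sum, mul_ite, mul_zero]

/-- The permutations below are sorted by the image of `none`. If it is fixed, it forms a cycle
alone. If it goes to `j`, then `j` lies in the cycle of `x`, and deleting `none` leaves a
permutation below `(x j) * γ` whose marked cycle, now read at `j`, has lost one point; hence `s +
1`. -/
theorem markedSum_insert (s : ℕ) (γ : Equiv.Perm V) (x : V) :
    markedSum κ s (swap none (some x) * optionCongr γ) none = κ (s + 1) * geodesicSum κ γ +
      ∑ i ∈ Finset.range (cycleLen γ x),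
        markedSum κ (s + 1) (swap x ((γ ^ i) x) * γ) ((γ ^ i) x) := by
  classical
  rw [← sum_cycleClass γ x fun j => markedSum κ (s + 1) (swap x j * γ) j, markedSum,
    finsum_eq_sum_of_fintype, sum_perm_option]
  congr 1
  · simp only [isGeodesic_optionCongr, markedProd, cycleLen_optionCongr_none,
      otherLens_optionCongr_none, geodesicSum, finsum_eq_sum_of_fintype, cycleProd, Finset.mul_sum, mul_ite, mul_zero]
  · symm
    refine Finset.sum_subset_zero_on_sdiff (Finset.subset_univ _) ?_ ?_
    · intro j hj
      refine Finset.sum_eq_zero fun β _ => if_neg fun h => ?_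
      have h1 := h.sameCycle none
      rw [sameCycle_insert_iff] at h1
      simp at hj
      exact hj (by simpa using h1)
    · intro j hj
      rw [mem_cycleClass] at hj
      rw [markedSum, finsum_eq_sum_of_fintype]
      refine Finset.sum_congr rfl fun β _ => ?_
      simp only [isGeodesic_insert hj, markedProd, cycleLen_insert, otherLens_insert]
      rw [add_right_comm, add_assoc]

end Sums

/-! ### The recursion for free moments -/

section Recursion

variable {S : Type*} [CommRing S] (κ : ℕ → S)

/-- The coefficients of the solution `w s` of `w s = κ s + X * w 0 * w (s + 1)`. -/
def freeMoment (n s : ℕ) : S :=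
  match n with
  | 0 => κ s
  | n + 1 => ∑ i : Fin (n + 1), freeMoment i 0 * freeMoment (n - i) (s + 1)
termination_by n
decreasing_by all_goals omega

theorem freeMoment_zero (s : ℕ) : freeMoment κ 0 s = κ s := by
  rw [freeMoment]

theorem freeMoment_succ (n s : ℕ) : freeMoment κ (n + 1) s =
    ∑ i ∈ Finset.range (n + 1), freeMoment κ i 0 * freeMoment κ (n - i) (s + 1) := by
  rw [freeMoment, Finset.sum_range]

variable {κ}

/-- The cut at `i` leaves an unmarked cycle of length `i` and a marked one of length `cycleLen γ x -
i`, which is the `i`-th term of `freeMoment_succ`. The last term, `i = cycleLen γ x`, is the case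
where `none` is fixed. -/
theorem markedSum_insert_eq (h0 : κ 0 = 1) {V : Type*} [Fintype V] [DecidableEq V] (s : ℕ)
    (γ : Equiv.Perm V) (x : V)
    (h1 : geodesicSum κ γ = cycleProd (freeMoment κ · 0) γ)
    (h2 : ∀ (s : ℕ) (σ : Equiv.Perm V) (v : V), markedSum κ s σ v =
      freeMoment κ (cycleLen σ v) s * ((otherLens σ v).map (freeMoment κ · 0)).prod) :
    markedSum κ s (swap none (some x) * optionCongr γ) none =
      freeMoment κ (cycleLen γ x + 1) s * ((otherLens γ x).map (freeMoment κ · 0)).prod := by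
  rw [markedSum_insert, h1, cycleProd, allLens_eq_cons γ x, Multiset.map_cons, Multiset.prod_cons,
    freeMoment_succ, Finset.sum_range_succ, Nat.sub_self, freeMoment_zero, add_mul,
    Finset.sum_mul, add_comm]
  congr 1
  · refine Finset.sum_congr rfl fun i hi => ?_
    rw [Finset.mem_range] at hi
    rw [h2, cycleLen_swap_mul hi]
    rcases Nat.eq_zero_or_pos i with rfl | hi0
    -- For `i = 0` nothing is cut, and the missing factor is `freeMoment κ 0 0 = κ 0 = 1`.
    · simp [swap_self, ← one_def, freeMoment_zero, h0]
    · rw [otherLens_swap_mul hi hi0, Multiset.map_cons, Multiset.prod_cons]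
      ring
  · ring

/-- The unmarked formula alone is not stable under deleting a point, so it is proved together with
the marked one for all `s`, by induction on the number of points. -/
theorem markedSum_eq (h0 : κ 0 = 1) (n : ℕ) :
    (∀ (V : Type) [Fintype V], Fintype.card V = n → ∀ γ : Equiv.Perm V,
      geodesicSum κ γ = cycleProd (freeMoment κ · 0) γ) ∧
    ∀ (V : Type) [Fintype V], Fintype.card V = n → ∀ (s : ℕ) (γ : Equiv.Perm V) (v : V),
      markedSum κ s γ v =
        freeMoment κ (cycleLen γ v) s * ((otherLens γ v).map (freeMoment κ · 0)).prod := by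
  classical
  induction n with
  | zero =>
    refine ⟨fun V _ hV γ => ?_, fun V _ hV s γ v => ?_⟩
    · have := Fintype.card_eq_zero_iff.1 hV
      rw [geodesicSum_of_isEmpty, cycleProd, allLens_of_isEmpty]
      simp
    · exact (Fintype.card_eq_zero_iff.1 hV).elim v
  | succ n ih =>
    have key : ∀ (V : Type) [Fintype V], Fintype.card V = n + 1 →
        ∀ (s : ℕ) (γ : Equiv.Perm V) (v : V), markedSum κ s γ v =
          freeMoment κ (cycleLen γ v) s * ((otherLens γ v).map (freeMoment κ · 0)).prod := by
      intro V _ hV s γ v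
      -- The set is identified with `Option {x // x ≠ v}` so that the marked point becomes `none`.
      have hc : Fintype.card {x // x ≠ v} = n := by
        rw [Fintype.card_subtype_compl, hV]
        simp
      have hv : (Equiv.optionSubtypeNe v).symm v = none := by simp
      rw [← markedSum_permCongr κ (Equiv.optionSubtypeNe v).symm,
        ← cycleLen_permCongr (Equiv.optionSubtypeNe v).symm,
        ← otherLens_permCongr (Equiv.optionSubtypeNe v).symm, hv]
      generalize (Equiv.optionSubtypeNe v).symm.permCongr γ = τ
      obtain ⟨⟨y, σ⟩, rfl⟩ := decomposeOption.symm.surjective τ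
      rw [decomposeOption_symm_apply]
      rcases y with _ | x
      · simp only [swap_self, ← one_def, one_mul]
        rw [markedSum_optionCongr, cycleLen_optionCongr_none, otherLens_optionCongr_none,
          ih.1 _ hc, freeMoment_succ]
        simp [freeMoment_zero, h0, cycleProd]
      · rw [markedSum_insert_eq h0 s σ x (ih.1 _ hc σ) (ih.2 _ hc), cycleLen_insert,
          otherLens_insert]
    refine ⟨fun V _ hV γ => ?_, key⟩
    have : Nonempty V := Fintype.card_pos_iff.1 (by omega)
    obtain ⟨v⟩ := this
    rw [← markedSum_zero κ γ v, key V hV, cycleProd, allLens_eq_cons γ v, Multiset.map_cons,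
      Multiset.prod_cons]

theorem geodesicSum_eq (h0 : κ 0 = 1) {V : Type} [Fintype V] (γ : Equiv.Perm V) :
    geodesicSum κ γ = cycleProd (freeMoment κ · 0) γ :=
  (markedSum_eq h0 _).1 V rfl γ

end Recursion

end Equiv.Perm

/-! ### Factorisations of `(0_γ, γ)` -/

theorem Equiv.Perm.isConj_of_sameCycle {m : ℕ} {σ τ : Equiv.Perm (Fin m)}
    (hσ : ∀ x y, σ.SameCycle x y) (hτ : ∀ x y, τ.SameCycle x y) : IsConj σ τ := by
  rcases subsingleton_or_nontrivial (Fin m) with h | h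
  · rw [Subsingleton.elim σ τ]
  · have key : ∀ ρ : Equiv.Perm (Fin m), (∀ x y, ρ.SameCycle x y) → ∀ x, ρ x ≠ x := by
      intro ρ hρ x hx
      obtain ⟨y, hy⟩ := exists_ne x
      exact hy ((hρ x y).eq_of_left hx).symm
    have hc : ∀ ρ : Equiv.Perm (Fin m), (∀ x y, ρ.SameCycle x y) →
        ρ.IsCycle ∧ ρ.support = Finset.univ := by
      intro ρ hρ
      obtain ⟨x, -⟩ := exists_pair_ne (Fin m)
      exact ⟨⟨x, key ρ hρ x, fun y _ => hρ x y⟩,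
        Finset.eq_univ_of_forall fun y => Equiv.Perm.mem_support.2 (key ρ hρ y)⟩
    rw [(hc σ hσ).1.isConj_iff (hc τ hτ).1, (hc σ hσ).2, (hc τ hτ).2]

theorem sameCycle_finRotate {m : ℕ} (x y : Fin m) : (finRotate m).SameCycle x y := by
  rcases m with _ | _ | m
  · exact x.elim0
  · have : Subsingleton (Fin (0 + 1)) := inferInstanceAs (Subsingleton (Fin 1))
    rw [Subsingleton.elim x y]
  · have h : ∀ z : Fin (m + 2), finRotate (m + 2) z ≠ z := fun z => by
      have := Equiv.Perm.mem_support.1 (support_finRotate (n := m) ▸ Finset.mem_univ z)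
      exact this
    exact isCycle_finRotate.sameCycle (h x) (h y)

namespace PartitionedPerm

open Equiv.Perm

/-- The partitioned permutation `(0_σ, σ)`. -/
def ofPerm {d : ℕ} (σ : Equiv.Perm (Fin d)) : PartitionedPerm d := ⟨SameCycle.setoid σ, σ, le_rfl⟩

theorem full_finRotate (d : ℕ) : full (finRotate d) = ofPerm (finRotate d) := by
  refine PartitionedPerm.ext ?_ rfl
  exact (eq_top_iff.2 fun x y _ => sameCycle_finRotate x y).symm

theorem mul_eq_some_iff {d : ℕ} {p q r : PartitionedPerm d} :
    p.mul q = some r ↔ p.colength + q.colength = r.colength ∧ p.extMul q = r := by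
  rw [mul]
  split_ifs with h
  · rw [Option.some.injEq]
    constructor
    · rintro rfl
      exact ⟨h, rfl⟩
    · exact And.right
  · simp only [false_iff]
    rintro ⟨h1, rfl⟩
    exact h h1

/-- Two inequalities hold for any `q` whose product partition is `0_γ`: the rank inequality for
`0_α` and `q.part`, and `#q.part ≤ #cycles`. Additivity of colength says that their defects sum to
zero, so both are equalities. Conversely, a geodesic has the right join by `IsGeodesic.sup_eq`. -/
theorem ofPerm_mul_eq_some_iff {d : ℕ} {α γ : Equiv.Perm (Fin d)} {q : PartitionedPerm d} :
    (ofPerm α).mul q = some (ofPerm γ) ↔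
      q = ofPerm q.perm ∧ α * q.perm = γ ∧ IsGeodesic γ q.perm := by
  rw [mul_eq_some_iff, PartitionedPerm.ext_iff, PartitionedPerm.ext_iff]
  have hr := Setoid.card_quotient_add_le (SameCycle.setoid α) q.part
  have hq := Setoid.card_quotient_le q.cycles_le
  rw [Nat.card_eq_fintype_card (α := Fin d), Fintype.card_fin] at hr
  simp only [IsGeodesic, numCycles, colength, extMul, ofPerm, and_true,
    Nat.card_eq_fintype_card (α := Fin d), Fintype.card_fin]
  constructor
  · rintro ⟨h1, h2, rfl⟩
    rw [h2] at hr
    have h3 : SameCycle.setoid q.perm = q.part :=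
      Setoid.eq_of_le_of_card_quotient_le q.cycles_le (by omega)
    rw [h3] at h1 ⊢
    rw [mul_inv_cancel_right]
    refine ⟨rfl, rfl, by omega⟩
  · rintro ⟨h1, rfl, h3⟩
    have h4 := IsGeodesic.sup_eq (γ := α * q.perm) (β := q.perm) (by
      simpa [IsGeodesic, numCycles] using h3)
    rw [mul_inv_cancel_right] at h3 h4
    rw [h1]
    refine ⟨by omega, h4, rfl⟩

theorem restrict_isConj_finRotate {d : ℕ} (σ : Equiv.Perm (Fin d))
    (A : Quotient (ofPerm σ).part) : IsConj ((ofPerm σ).restrict A) (finRotate _) := by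
  refine isConj_of_sameCycle (fun x y => ?_) sameCycle_finRotate
  obtain ⟨x, rfl⟩ := (Finite.equivFin _).surjective x
  obtain ⟨y, rfl⟩ := (Finite.equivFin _).surjective y
  rw [restrict, sameCycle_permCongr, sameCycle_subtypePerm]
  exact Quotient.exact (x.2.trans y.2.symm)

end PartitionedPerm

/-! ### Convolution with zeta on full cycles -/

namespace PSFun

open Equiv.Perm PartitionedPerm

variable {S : Type*} [CommRing S]

open Classical in
theorem conv_zeta_ofPerm (f : PSFun S) {d : ℕ} (γ : Equiv.Perm (Fin d)) :
    conv (zeta S) f d (ofPerm γ) = ∑ᶠ β, if IsGeodesic γ β then f d (ofPerm β) else 0 := by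
  rw [finsum_eq_sum_of_fintype, ← Finset.sum_filter, conv]
  simp only [zeta, ite_mul, one_mul, zero_mul]
  rw [← Finset.sum_filter, Finset.filter_filter]
  have hp : ∀ p : PartitionedPerm d, p.part = SameCycle.setoid p.perm → p = ofPerm p.perm :=
    fun p h => PartitionedPerm.ext h rfl
  refine Finset.sum_bij' (fun ab _ => ab.2.perm) (fun β _ => (ofPerm (γ * β⁻¹), ofPerm β))
    ?_ ?_ ?_ ?_ ?_
  · rintro ⟨a, b⟩ h
    simp only [Finset.mem_filter, Finset.mem_univ, true_and] at h ⊢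
    rw [hp a h.2, ofPerm_mul_eq_some_iff] at h
    exact h.1.2.2
  · intro β h
    simp only [Finset.mem_filter, Finset.mem_univ, true_and] at h ⊢
    rw [ofPerm_mul_eq_some_iff]
    exact ⟨⟨rfl, inv_mul_cancel_right γ β, h⟩, rfl⟩
  · rintro ⟨a, b⟩ h
    simp only [Finset.mem_filter, Finset.mem_univ, true_and] at h
    obtain ⟨h1, h2⟩ := h
    rw [hp a h2, ofPerm_mul_eq_some_iff] at h1
    refine Prod.ext ?_ h1.1.symm
    change ofPerm (γ * b.perm⁻¹) = a
    rw [← h1.2.1, mul_inv_cancel_right, ← hp a h2]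
  · intro β _
    rfl
  · rintro ⟨a, b⟩ h
    simp only [Finset.mem_filter, Finset.mem_univ, true_and] at h
    rw [hp a h.2, ofPerm_mul_eq_some_iff] at h
    exact congrArg (f d) h.1.1

/-- The free cumulants `f (1_n, (1 2 ⋯ n))`, with value `1` at `n = 0`. -/
noncomputable def cumulant (f : PSFun S) (n : ℕ) : S :=
  if n = 0 then 1 else f n (full (finRotate n))

theorem IsMultiplicative.apply_ofPerm {f : PSFun S} (hf : f.IsMultiplicative) {d : ℕ}
    (σ : Equiv.Perm (Fin d)) : f d (ofPerm σ) = cycleProd f.cumulant σ := by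
  classical
  rw [hf.prod, cycleProd, ← map_card_quotient, Multiset.map_map]
  refine Finset.prod_congr (by congr!) fun A _ => ?_
  change _ = f.cumulant (Nat.card {x // Quotient.mk (ofPerm σ).part x = A})
  rw [hf.conj _ _ _ (restrict_isConj_finRotate σ A), cumulant, if_neg]
  -- Blocks are nonempty, so the conventional value of `cumulant` at `0` never enters.
  obtain ⟨x, rfl⟩ := Quotient.exists_rep A
  have : Nonempty {y // Quotient.mk (ofPerm σ).part y = Quotient.mk _ x} := ⟨⟨x, rfl⟩⟩
  exact Nat.card_pos.ne'

/-- For a full cycle `1_n = 0_γ`, so the geodesic sum applies, and its product over the cycles of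
`γ` has a single factor. -/
theorem cumulant_conv_zeta {f : PSFun S} (hf : f.IsMultiplicative) (n : ℕ) :
    (conv (zeta S) f).cumulant n = freeMoment f.cumulant n 0 := by
  rcases n with _ | n
  · rw [freeMoment_zero]
    rfl
  · rw [cumulant, if_neg n.succ_ne_zero, full_finRotate, conv_zeta_ofPerm]
    have h := geodesicSum_eq (κ := f.cumulant) (if_pos rfl) (finRotate (n + 1))
    have h1 : cycleClass (finRotate (n + 1)) 0 = Finset.univ := Finset.eq_univ_of_forall fun y =>
      mem_cycleClass.2 (sameCycle_finRotate 0 y)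
    have h2 : otherClasses (finRotate (n + 1)) 0 = ∅ := Finset.eq_empty_of_forall_notMem fun c hc =>
      have ⟨w, hw, _⟩ := mem_otherClasses.1 hc
      hw (sameCycle_finRotate 0 w)
    rw [cycleProd, allLens_eq_cons _ 0, otherLens, h2, cycleLen, h1] at h
    simpa [geodesicSum, hf.apply_ofPerm] using h

end PSFun

/-! ### Solving the functional equations after the change of variable -/

namespace PowerSeries

variable {R : Type*} [CommRing R]

/-- Uniqueness principle for the recursions in `s`: each use of the equation gains a factor `X`, so
every power of `X` divides every `E s`. -/
theorem eq_zero_of_eq_X_mul {E a b : ℕ → R⟦X⟧}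
    (h : ∀ s, E s = X * (a s * E (s + 1) + b s * E 0)) (s : ℕ) : E s = 0 := by
  have h1 : ∀ n s, X ^ n ∣ E s := by
    intro n
    induction n with
    | zero => simp
    | succ n ih =>
      intro s
      rw [h s, pow_succ']
      exact mul_dvd_mul_left _ (dvd_add ((ih _).mul_left _) ((ih _).mul_left _))
  ext n
  exact X_pow_dvd_iff.1 (h1 (n + 1) s) n n.lt_succ_self

theorem mk_eq_C_add_X_mul (κ : ℕ → R) (s : ℕ) :
    mk (fun n => κ (s + n)) = C (κ s) + X * mk (fun n => κ (s + 1 + n)) := by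
  ext n
  rcases n with _ | n
  · simp
  · simp [coeff_succ_X_mul, add_assoc, add_comm 1]

theorem mk_eq_of_coeff {f : ℕ → R} {c : R} {p : R⟦X⟧} (h0 : f 0 = c)
    (h : ∀ n, f (n + 1) = coeff n p) : mk f = C c + X * p := by
  ext n
  rcases n with _ | n
  · simp [h0]
  · simp [coeff_succ_X_mul, h]

variable {κ κ' : ℕ → R} {F H : ℕ → R⟦X⟧}

/-- The shifted series `T_s = ∑ κ_{s+n} w^n` satisfy `T_s = κ_s + w T_{s+1}`, and `w = X(w) T_0`; so
they solve the substituted recursion, and uniqueness applies. -/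
theorem subst_changeVar_eq_mk (h0 : κ 0 = 1) (hF : ∀ s, F s = C (κ s) + X * (F 0 * F (s + 1)))
    (s : ℕ) : (F s).subst (changeVar (mk κ)) = mk fun n => κ (s + n) := by
  have hs := hasSubst_changeVar (mk κ)
  have hX := changeVar_mul (mk κ) (by simpa using h0)
  -- The coefficients come from `y_0 y_{s+1} - T_0 T_{s+1} = y_0 (y_{s+1} - T_{s+1}) + (y_0 - T_0)
  -- T_{s+1}`, with `y_s` the substituted `F s`.
  refine sub_eq_zero.1 (eq_zero_of_eq_X_mul
    (E := fun s => (F s).subst (changeVar (mk κ)) - mk fun n => κ (s + n))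
    (a := fun s => invOfUnit (mk κ) 1 * (F 0).subst (changeVar (mk κ)))
    (b := fun s => invOfUnit (mk κ) 1 * mk fun n => κ (s + 1 + n)) (fun s => ?_) s)
  have h1 : (F s).subst (changeVar (mk κ)) = C (κ s) + changeVar (mk κ) *
      ((F 0).subst (changeVar (mk κ)) * (F (s + 1)).subst (changeVar (mk κ))) := by
    conv_lhs => rw [hF s]
    rw [subst_add hs, subst_mul hs, subst_mul hs, subst_X hs, subst_C]
    rfl
  simp only [zero_add]
  rw [h1, mk_eq_C_add_X_mul κ s]
  generalize (F 0).subst (changeVar (mk κ)) = N, (F (s + 1)).subst (changeVar (mk κ)) = N'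
  rw [changeVar] at hX ⊢
  linear_combination (mk fun n => κ (s + 1 + n)) * hX

/-- After substitution the equation is affine: `h_s = κ'_s + w h_{s+1} + X(w) h_0 T_{s+1}`.
Iterating in `s` produces `∑ w^m T_{m+1} = dG/dw` at `s = 0`, where `G = mk κ`, whence `h_0 (1 -
X(w) dG/dw) = ∑ κ'_n w^n`. Differentiating `X(w) G = w` identifies the bracket with `G dX/dw`. -/
theorem subst_changeVar_tangent (h0 : κ 0 = 1) (hF : ∀ s, F s = C (κ s) + X * (F 0 * F (s + 1)))
    (hH : ∀ s, H s = C (κ' s) + X * (F 0 * H (s + 1) + H 0 * F (s + 1))) :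
    (H 0).subst (changeVar (mk κ)) = logDerivRatio (mk κ) * mk κ' := by
  have hs := hasSubst_changeVar (mk κ)
  have hc : constantCoeff (mk κ) = 1 := by simpa using h0
  have hX := changeVar_mul (mk κ) hc
  have hFs := subst_changeVar_eq_mk h0 hF
  have hF0 : (F 0).subst (changeVar (mk κ)) = mk κ := by simpa using hFs 0
  have h1 : ∀ s, (H s).subst (changeVar (mk κ)) = C (κ' s) +
      X * (H (s + 1)).subst (changeVar (mk κ)) + changeVar (mk κ) *
        ((H 0).subst (changeVar (mk κ)) * mk fun n => κ (s + 1 + n)) := by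
    intro s
    conv_lhs => rw [hH s]
    rw [subst_add hs, subst_mul hs, subst_add hs, subst_mul hs, subst_mul hs, subst_X hs, subst_C,
      hFs (s + 1), hF0, mul_add, ← mul_assoc (changeVar (mk κ)) (mk κ), hX, add_assoc]
    rfl
  -- This series is the closed form of `∑ w^m T_{s+1+m}`.
  have hD : ∀ s, mk (fun n => (n + 1 : R) * κ (s + n + 1)) =
      mk (fun n => κ (s + 1 + n)) + X * mk (fun n => (n + 1 : R) * κ (s + 1 + n + 1)) := by
    intro s
    ext n
    rcases n with _ | n
    · simp
    · simp [coeff_succ_X_mul, add_right_comm, ← add_assoc]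
      ring
  have h2 : (H 0).subst (changeVar (mk κ)) - (mk κ' + changeVar (mk κ) *
      (H 0).subst (changeVar (mk κ)) * derivative R (mk κ)) = 0 := by
    have h3 := eq_zero_of_eq_X_mul
      (E := fun s => (H s).subst (changeVar (mk κ)) - (mk (fun n => κ' (s + n)) +
        changeVar (mk κ) * (H 0).subst (changeVar (mk κ)) *
          mk (fun n => (n + 1 : R) * κ (s + n + 1))))
      (a := 1) (b := 0) (fun s => by
        simp only [Pi.one_apply, Pi.zero_apply]
        rw [hD s, mk_eq_C_add_X_mul κ' s, h1 s]
        ring) 0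
    have h4 : derivative R (mk κ) = mk (fun n => (n + 1 : R) * κ (0 + n + 1)) := by
      ext n
      simp [coeff_derivative, mul_comm]
    rw [h4]
    simpa using h3
  have hC : invOfUnit (mk κ) 1 * mk κ = 1 := by
    rw [mul_comm]
    exact mul_invOfUnit _ _ (by simpa using h0)
  have hdX : derivative R (changeVar (mk κ)) * mk κ + changeVar (mk κ) * derivative R (mk κ) =
      1 := by
    have := congrArg (derivative R) hX
    rw [Derivation.leibniz, derivative_X, smul_eq_mul, smul_eq_mul] at this
    rw [← this]
    ring
  have hI := mul_invOfUnit (derivative R (changeVar (mk κ))) 1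
    (by simpa using constantCoeff_derivative_changeVar (mk κ))
  rw [logDerivRatio]
  generalize (H 0).subst (changeVar (mk κ)) = L at *
  have h5 : derivative R (changeVar (mk κ)) * mk κ * L = mk κ' := by
    linear_combination h2 + L * hdX
  rw [← h5]
  linear_combination (-L) * hI - L * derivative R (changeVar (mk κ)) *
    invOfUnit (derivative R (changeVar (mk κ))) 1 * hC

end PowerSeries

/-! ### Components over the dual numbers and the conclusion -/

namespace PSFun

open PowerSeries

variable {R : Type*} [CommRing R]

theorem genusZeroSeries_eq_mk (φ φ' : PSFun R) :
    φ.genusZeroSeries = mk fun n => ((flat φ φ').cumulant n).fst := by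
  ext n
  by_cases h : n = 0 <;> simp [genusZeroSeries, cumulant, flat, h]

theorem genusHalfSeries_eq_mk (φ φ' : PSFun R) :
    φ'.genusHalfSeries = mk fun n => ((flat φ φ').cumulant n).snd := by
  ext n
  by_cases h : n = 0 <;> simp [genusHalfSeries, cumulant, flat, h]

end PSFun

open PowerSeries Equiv.Perm in
theorem freeMoment_fst_series {R : Type*} [CommRing R] (κ : ℕ → DualNumber R) (s : ℕ) :
    mk (fun n => (freeMoment κ n s).fst) = C (κ s).fst + X *
      (mk (fun n => (freeMoment κ n 0).fst) * mk (fun n => (freeMoment κ n (s + 1)).fst)) := by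
  refine mk_eq_of_coeff (by rw [freeMoment_zero]) fun n => ?_
  rw [freeMoment_succ, TrivSqZeroExt.fst_sum, coeff_mul,
    Finset.Nat.sum_antidiagonal_eq_sum_range_succ_mk]
  simp

-- The `ħ`-component of a product obeys the Leibniz rule, so the recursion is linearised along its
-- genus `0` solution.
open PowerSeries Equiv.Perm in
theorem freeMoment_snd_series {R : Type*} [CommRing R] (κ : ℕ → DualNumber R) (s : ℕ) :
    mk (fun n => (freeMoment κ n s).snd) = C (κ s).snd + X *
      (mk (fun n => (freeMoment κ n 0).fst) * mk (fun n => (freeMoment κ n (s + 1)).snd) +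
        mk (fun n => (freeMoment κ n 0).snd) * mk (fun n => (freeMoment κ n (s + 1)).fst)) := by
  refine mk_eq_of_coeff (by rw [freeMoment_zero]) fun n => ?_
  rw [freeMoment_succ, TrivSqZeroExt.snd_sum, map_add, coeff_mul, coeff_mul,
    Finset.Nat.sum_antidiagonal_eq_sum_range_succ_mk,
    Finset.Nat.sum_antidiagonal_eq_sum_range_succ_mk, ← Finset.sum_add_distrib]
  simp

theorem mainTheorem6 {R : Type*} [CommRing R] (φ φ' φv φv' : PSFun R)
    (hφ : (PSFun.flat φ φ').IsMultiplicative) (hφv : (PSFun.flat φv φv').IsMultiplicative)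
    (hconv : PSFun.flat φ φ' = PSFun.conv (PSFun.zeta (DualNumber R)) (PSFun.flat φv φv')) :
    PowerSeries.subst (changeVar φv.genusZeroSeries) φ.genusZeroSeries = φv.genusZeroSeries ∧
    PowerSeries.subst (changeVar φv.genusZeroSeries) φ'.genusHalfSeries =
      logDerivRatio φv.genusZeroSeries * φv'.genusHalfSeries ∧
    ((PowerSeries.subst (changeVar φv.genusZeroSeries) φ'.genusHalfSeries : R⟦X⟧) :
        LaurentSeries R) * dlog (changeVar φv.genusZeroSeries) =
      (φv'.genusHalfSeries : LaurentSeries R) * dlog PowerSeries.X := by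
  have h0 : ((PSFun.flat φv φv').cumulant 0).fst = 1 := by simp [PSFun.cumulant]
  have hm : ∀ n, (PSFun.flat φ φ').cumulant n =
      Equiv.Perm.freeMoment (PSFun.flat φv φv').cumulant n 0 := fun n => by
    rw [hconv, PSFun.cumulant_conv_zeta hφv]
  have hG : PowerSeries.subst (changeVar φv.genusZeroSeries) φ.genusZeroSeries =
      φv.genusZeroSeries := by
    rw [PSFun.genusZeroSeries_eq_mk φ φ', PSFun.genusZeroSeries_eq_mk φv φv']
    simp only [hm]
    simpa using PowerSeries.subst_changeVar_eq_mk h0 (freeMoment_fst_series _) 0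
  have hH : PowerSeries.subst (changeVar φv.genusZeroSeries) φ'.genusHalfSeries =
      logDerivRatio φv.genusZeroSeries * φv'.genusHalfSeries := by
    rw [PSFun.genusHalfSeries_eq_mk φ φ', PSFun.genusHalfSeries_eq_mk φv φv',
      PSFun.genusZeroSeries_eq_mk φv φv']
    simp only [hm]
    exact PowerSeries.subst_changeVar_tangent h0 (freeMoment_fst_series _)
      (freeMoment_snd_series _)
  refine ⟨hG, hH, ?_⟩
  -- The differential form follows from the second identity because `logDerivRatio` times `dX / X`
  -- is `dw / w`.
  rw [hH, PowerSeries.coe_mul, mul_right_comm, mul_comm,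
    logDerivRatio_mul_dlog _ (PSFun.constantCoeff_genusZeroSeries φv)]
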